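/- Let $\kappa$ be an uncountable cardinal and let $\delta<\kappa$ be a cardinal. For a cardinal $\theta\le\kappa$, call $\kappa$ *$\theta$-strongly compact* if for every set $A$, every $\kappa$-complete proper filter over $A$ can be extended to a $\theta$-complete ultrafilter over $A$; here a filter is $c$-complete if it is closed under intersections of fewer than $c$ of its members. (When $\delta$ is infinite, $\theta=\delta^+$ is uncountable and this is the usual notion of a $\delta^+$-strongly compact cardinal.) For a cardinal $\mu$, a topological space $X$ is *$\mu$-Lindelöf* if every open cover of $X$ has a subcover of size $<\mu$. Then the following are equivalent: 1. $\kappa$ is $\delta^+$-strongly compact. 2. Regarding $\delta$ as a discrete topological space, for every cardinal $\lambda$ the product space $\delta^\lambda$ (with the product topology) is $\kappa$-Lindelöf. -/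

import Mathlib

open Cardinal

universe u

/-- `κ` is `θ`-strongly compact: every `κ`-complete (proper) filter over any set `A` extends to a
`θ`-complete ultrafilter over `A`. A filter is `c`-complete if it is closed under intersections of
fewer than `c` of its members (`CardinalInterFilter`). The notion is normally used for uncountable
`θ ≤ κ`; no such restriction is built into the definition. In Mathlib's order on filters,
`↑U ≤ F` says that every member of `F` belongs to `U`. -/
def IsStronglyCompactFor (κ θ : Cardinal.{u}) : Prop :=
  ∀ (A : Type u) (F : Filter A), F.NeBot → CardinalInterFilter F κ →
    ∃ U : Ultrafilter A, (U : Filter A) ≤ F ∧ CardinalInterFilter (U : Filter A) θ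

/-- `X` is `μ`-Lindelöf: every open cover of `X` has a subcover of size `< μ`. -/
def IsCardLindelof (μ : Cardinal.{u}) (X : Type u) [TopologicalSpace X] : Prop :=
  ∀ 𝒰 : Set (Set X), (∀ O ∈ 𝒰, IsOpen O) → ⋃₀ 𝒰 = Set.univ →
    ∃ 𝒱 ⊆ 𝒰, #𝒱 < μ ∧ ⋃₀ 𝒱 = Set.univ

open Filter Set Topology

/-! Write `δ = #D`. If a cover of `I → D` had no subcover of size `< κ`, choose for each small
subfamily a point it misses. Modulo a `δ⁺`-complete fine ultrafilter on the small subfamilies, each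
coordinate of these points is constant, so they converge; the member of the cover containing the
limit contradicts fineness. Conversely, send `A` to `(A → D) → D` by evaluation. The Lindelöf
property gives a cluster point of the image of `F`, and an ultrafilter refining `F` and converging
to it makes every map `A → D` constant almost everywhere, which is `δ⁺`-completeness. The hard point
is fineness at `κ` itself when `κ` is singular: it is obtained at `κ⁺` and brought down by
`HasFineUltrafilter.of_succ_of_isSingular`. -/

/-- `X` carries a `θ`-complete fine ultrafilter on its subsets of size `< μ`, presented as an
ultrafilter `U` on an index type together with a family of such subsets. -/
def HasFineUltrafilter (θ μ : Cardinal.{u}) (X : Type u) : Prop :=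
  ∃ (A : Type u) (U : Ultrafilter A) (y : A → Set X),
    CardinalInterFilter (U : Filter A) θ ∧ (∀ a, #(y a) < μ) ∧ ∀ i, ∀ᶠ a in (U : Filter A), i ∈ y a

theorem HasFineUltrafilter.of_injective {θ μ : Cardinal.{u}} {X Y : Type u}
    (h : HasFineUltrafilter θ μ Y) {f : X → Y} (hf : Function.Injective f) :
    HasFineUltrafilter θ μ X := by
  obtain ⟨A, U, y, hU, hy, hfine⟩ := h
  exact ⟨A, U, fun a => f ⁻¹' y a, hU,
    fun a => (Cardinal.mk_preimage_of_injective f (y a) hf).trans_lt (hy a), fun i => hfine (f i)⟩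

/-- The cones `{a | t ⊆ a}` with `#t < μ` generate a `μ`-complete filter, since regularity of `μ`
keeps unions of fewer than `μ` such `t` small. -/
theorem IsStronglyCompactFor.hasFineUltrafilter {κ θ μ : Cardinal.{u}}
    (h : IsStronglyCompactFor κ θ) (hμ : μ.IsRegular) (hκμ : κ ≤ μ) (X : Type u) :
    HasFineUltrafilter θ μ X := by
  let A := {s : Set X // #s < μ}
  let l : Set (Set A) := {S | ∃ t : Set X, #t < μ ∧ ∀ a : A, t ⊆ a.1 → a ∈ S}
  have hl : ∀ S : Set (Set A), #S < μ → S ⊆ l → ⋂₀ S ∈ l := by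
    intro S hS hSl
    choose t ht hta using fun s : S => hSl s.2
    refine ⟨⋃ s, t s, (card_iUnion_lt_iff_forall_of_isRegular hμ hS).2 ht, fun a ha s hs => ?_⟩
    exact hta ⟨s, hs⟩ a ((subset_iUnion t ⟨s, hs⟩).trans ha)
  have h2 : 2 < μ := (Cardinal.natCast_lt_aleph0 (n := 2)).trans_le hμ.aleph0_le
  let F : Filter A := Filter.ofCardinalInter l h2 hl
    fun s t ⟨r, hr, hrs⟩ hst => ⟨r, hr, fun a ha => hst (hrs a ha)⟩
  have hF : CardinalInterFilter F μ := inferInstance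
  have hne : F.NeBot := by
    refine ⟨fun hbot => ?_⟩
    have : (∅ : Set A) ∈ F := by rw [hbot]; trivial
    obtain ⟨t, ht, hta⟩ := this
    exact hta ⟨t, ht⟩ Subset.rfl
  obtain ⟨U, hUF, hU⟩ := h A F hne (CardinalInterFilter.of_cardinalInterFilter_of_le F hκμ)
  refine ⟨A, U, Subtype.val, hU, fun a => a.2, fun i => hUF ⟨{i}, ?_, fun a ha => by simpa using ha⟩⟩
  rw [Cardinal.mk_singleton]
  exact Cardinal.one_lt_aleph0.trans_le hμ.aleph0_le

theorem Filter.wellFounded_eventually_lt {A L : Type*} [LT L] [WellFoundedLT L]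
    (l : Filter A) [l.NeBot] [CountableInterFilter l] :
    WellFounded fun f g : A → L => ∀ᶠ a in l, f a < g a := by
  rw [wellFounded_iff_isEmpty_descending_chain]
  refine ⟨fun ⟨f, hf⟩ => ?_⟩
  obtain ⟨a, ha⟩ := (eventually_countable_forall.2 hf).exists
  exact (wellFounded_iff_isEmpty_descending_chain.1 (wellFounded_lt (α := L))).false
    ⟨fun n => f n a, ha⟩

theorem exists_forall_lt_of_mk_lt_cof {L : Type u} [LinearOrder L] {s : Set L}
    (hs : #s < Order.cof L) : ∃ b, ∀ x ∈ s, x < b :=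
  not_isCofinal_iff.1 fun h => (Order.cof_le h).not_gt hs

/-- The intervals `[e i, s (e i))` are then pairwise disjoint. -/
theorem exists_forall_lt_map_le {L : Type u} [LinearOrder L] [WellFoundedLT L]
    (hL : ∀ i : L, #(Iio i) < Order.cof L) (s : L → L) :
    ∃ e : L → L, ∀ i j, i < j → s (e i) ≤ e j := by
  have hb : ∀ (i : L) (f : ∀ k, k < i → L), ∃ b, ∀ k hk, f k hk < b := by
    intro i f
    obtain ⟨b, hb⟩ := exists_forall_lt_of_mk_lt_cof
      (s := range fun k : Iio i => f k.1 k.2) (Cardinal.mk_range_le.trans_lt (hL i))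
    exact ⟨b, fun k hk => hb _ ⟨⟨k, hk⟩, rfl⟩⟩
  choose B hB using hb
  let e : L → L := (wellFounded_lt (α := L)).fix fun i f => B i fun k hk => s (f k hk)
  refine ⟨e, fun i j hij => ?_⟩
  have : e j = B j fun k _ => s (e k) := WellFounded.fix_eq _ _ _
  rw [this]
  exact (hB j (fun k _ => s (e k)) i hij).le

/-- If the cofinality of `Iio i` is at most the singular cardinal `κ`, it is smaller. -/
theorem exists_isCofinal_mk_lt_of_isSingular {κ : Cardinal.{u}} (hκ : κ.IsSingular) {P : Type u}
    [LinearOrder P] [WellFoundedLT P] (s : Set P) (hs : IsCofinal s) (hsκ : #s ≤ κ) :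
    ∃ t : Set P, IsCofinal t ∧ #t < κ := by
  obtain ⟨t, ht, htc⟩ := Order.exists_cof_eq P
  refine ⟨t, ht, ?_⟩
  rw [htc]
  -- A cofinality is its own cofinality, hence cannot be the singular `κ`.
  refine ((Order.cof_le hs).trans hsκ).lt_of_ne fun h => ?_
  have := Order.cof_ord_cof P
  rw [h] at this
  exact hκ.cof_ord_lt.ne this

/-- In the well-founded ultrapower of `L`, let `g` represent the supremum of the constants. Almost
every `y a` is cofinal below `g a`, so by singularity a set `C a` of size `< κ` is too. Almost every
`C a` meets each of a family of disjoint intervals indexed by `L`; the indices of the intervals met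
by `C a` form the new small sets. -/
theorem HasFineUltrafilter.of_succ_of_isSingular {κ θ : Cardinal.{u}} (hκ : κ.IsSingular)
    (hθ : ℵ₀ < θ) {L : Type u} [LinearOrder L] [WellFoundedLT L] [NoMaxOrder L]
    (hL : ∀ i : L, #(Iio i) < Order.cof L) (hκL : κ < Order.cof L)
    (h : HasFineUltrafilter θ (Order.succ κ) L) : HasFineUltrafilter θ κ L := by
  obtain ⟨A, U, y, hU, hy, hfine⟩ := h
  have : CountableInterFilter (U : Filter A) :=
    CardinalInterFilter.toCountableInterFilter (U : Filter A) hθ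
  have hy' : ∀ a, #(y a) ≤ κ := fun a => Order.lt_succ_iff.1 (hy a)
  -- The least function above all constants modulo `U`.
  let G : Set (A → L) := {g | ∀ b, ∀ᶠ a in (U : Filter A), b < g a}
  have hG : G.Nonempty := by
    choose g hg using fun a => exists_forall_lt_of_mk_lt_cof ((hy' a).trans_lt hκL)
    exact ⟨g, fun b => (hfine b).mono fun a ha => hg a b ha⟩
  obtain ⟨g, hgG, hgmin⟩ :=
    (Filter.wellFounded_eventually_lt (L := L) (U : Filter A)).has_min G hG
  have hbdd : ∀ f : A → L, (∀ᶠ a in (U : Filter A), f a < g a) →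
      ∃ b, ∀ᶠ a in (U : Filter A), f a ≤ b := by
    intro f hf
    by_contra! hcon
    exact hgmin f hcon hf
  have hcof : ∀ᶠ a in (U : Filter A), ∀ x < g a, ∃ z ∈ y a, x ≤ z ∧ z < g a := by
    -- Otherwise some `f a < g a` lies above all of `y a` below `g a`; minimality of `g` bounds `f`
    -- by a constant `b`, yet almost always `b ∈ y a` and `b < g a`.
    by_contra hcon
    have hcon := Ultrafilter.eventually_not.2 hcon
    have hch : ∀ a, ∃ x, ¬ (∀ x < g a, ∃ z ∈ y a, x ≤ z ∧ z < g a) →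
        x < g a ∧ ∀ z ∈ y a, z < g a → z < x := by
      intro a
      by_cases ha : ∀ x < g a, ∃ z ∈ y a, x ≤ z ∧ z < g a
      · exact ⟨g a, fun h => absurd ha h⟩
      · push Not at ha
        obtain ⟨x, hx, hxz⟩ := ha
        exact ⟨x, fun _ => ⟨hx, fun z hz hzg => lt_of_not_ge fun hle => (hxz z hz hle).not_gt hzg⟩⟩
    choose f hf using hch
    obtain ⟨b, hb⟩ := hbdd f (hcon.mono fun a ha => (hf a ha).1)
    obtain ⟨a, ha, hab, hba, hbg⟩ := (hcon.and (hb.and ((hfine b).and (hgG b)))).exists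
    exact ((hf a ha).2 b hba hbg).not_ge hab
  have hC : ∀ a, ∃ C : Set L, #C < κ ∧ (∀ z ∈ C, z < g a) ∧
      ((∀ x < g a, ∃ z ∈ y a, x ≤ z ∧ z < g a) → ∀ x < g a, ∃ z ∈ C, x ≤ z) := by
    intro a
    by_cases ha : ∀ x < g a, ∃ z ∈ y a, x ≤ z ∧ z < g a
    · obtain ⟨t, ht, htκ⟩ := exists_isCofinal_mk_lt_of_isSingular hκ (P := Iio (g a))
        (Subtype.val ⁻¹' y a)
        (fun x => by
          obtain ⟨z, hz, hxz, hzg⟩ := ha x.1 x.2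
          exact ⟨⟨z, hzg⟩, hz, hxz⟩)
        ((Cardinal.mk_preimage_of_injective _ _ Subtype.val_injective).trans (hy' a))
      refine ⟨Subtype.val '' t, Cardinal.mk_image_le.trans_lt htκ, ?_, fun _ x hx => ?_⟩
      · rintro _ ⟨z, -, rfl⟩
        exact z.2
      · obtain ⟨z, hz, hxz⟩ := ht ⟨x, hx⟩
        exact ⟨z, ⟨z, hz, rfl⟩, hxz⟩
    · exact ⟨∅, by simpa using hκ.pos, by simp, fun h => absurd h ha⟩
  choose C hCκ hCg hCcof using hC
  have hstep : ∀ x, ∃ x', ∀ᶠ a in (U : Filter A), ∃ z ∈ C a, x ≤ z ∧ z < x' := by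
    intro x
    have hx : ∀ᶠ a in (U : Filter A), ∃ z, z ∈ C a ∧ x ≤ z := by
      filter_upwards [hcof, hgG x] with a ha hxa using hCcof a ha x hxa
    obtain ⟨d, hd⟩ := hx.choice
    obtain ⟨b, hb⟩ := hbdd d (hd.mono fun a ha => hCg a _ ha.1)
    obtain ⟨x', hx'⟩ := exists_gt b
    refine ⟨x', ?_⟩
    filter_upwards [hd, hb] with a ha hab using ⟨d a, ha.1, ha.2, hab.trans_lt hx'⟩
  choose s hs using hstep
  obtain ⟨e, he⟩ := exists_forall_lt_map_le hL s
  refine ⟨A, U, fun a => {i | ∃ z ∈ C a, e i ≤ z ∧ z < s (e i)}, hU, fun a => ?_, fun i => hs (e i)⟩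
  refine lt_of_le_of_lt ?_ (hCκ a)
  -- Disjointness of the intervals makes `i ↦ z i` an injection into `C a`.
  choose z hzC hez hze using fun i : {i | ∃ z ∈ C a, e i ≤ z ∧ z < s (e i)} => i.2
  have hlt : ∀ i j, i < j → z i < z j := fun i j hij =>
    (hze i).trans_le ((he i j hij).trans (hez j))
  have hinj : StrictMono z := fun i j => hlt i j
  exact Cardinal.mk_le_of_injective (f := fun i => (⟨z i, hzC i⟩ : C a))
    fun i j hij => hinj.injective (congrArg Subtype.val hij)

theorem IsStronglyCompactFor.hasFineUltrafilter_self {κ θ : Cardinal.{u}}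
    (h : IsStronglyCompactFor κ θ) (hκ : ℵ₀ ≤ κ) (hθ : ℵ₀ < θ) (X : Type u) :
    HasFineUltrafilter θ κ X := by
  rcases Cardinal.isRegular_or_isSingular hκ with hreg | hsing
  · exact h.hasFineUltrafilter hreg le_rfl X
  -- A regular cardinal above `κ` and `#X`: its initial segments are shorter than its cofinality,
  -- and `X` embeds in it.
  let c := Order.succ (max κ #X)
  have hκc : ℵ₀ ≤ max κ #X := hκ.trans (le_max_left _ _)
  have hc : c.IsRegular := Cardinal.isRegular_succ hκc
  have hcof : Order.cof c.ord.ToType = c := by rw [Ordinal.cof_toType, hc.cof_ord]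
  have : NoMaxOrder c.ord.ToType := Cardinal.noMaxOrder hc.aleph0_le
  have hL : HasFineUltrafilter θ κ c.ord.ToType := by
    refine .of_succ_of_isSingular hsing hθ (fun i => ?_) ?_
      (h.hasFineUltrafilter (Cardinal.isRegular_succ hκ) (Order.le_succ κ) _)
    · rw [hcof]
      simpa using Cardinal.mk_Iio_lt i
    · rw [hcof]
      exact Order.lt_succ_iff.2 (le_max_left _ _)
  have hX : #X ≤ #c.ord.ToType := by
    rw [Cardinal.mk_ord_toType]
    exact (le_max_right _ _).trans (Order.le_succ _)
  obtain ⟨f⟩ := hX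
  exact hL.of_injective f.injective

theorem isCardLindelof_pi_of_hasFineUltrafilter {κ : Cardinal.{u}} {D : Type u}
    [TopologicalSpace D] [DiscreteTopology D]
    (h : ∀ X : Type u, HasFineUltrafilter (Order.succ #D) κ X) (I : Type u) :
    IsCardLindelof κ (I → D) := by
  intro 𝒰 hopen hcover
  by_contra! hcon
  obtain ⟨A, U, y, hU, hy, hfine⟩ := h 𝒰
  have hf : ∀ a, ∃ f : I → D, ∀ O ∈ y a, f ∉ O.1 := by
    intro a
    have := hcon (Subtype.val '' y a) (by rintro _ ⟨O, -, rfl⟩; exact O.2)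
      (Cardinal.mk_image_le.trans_lt (hy a))
    obtain ⟨f, hf⟩ := (ne_univ_iff_exists_notMem _).1 this
    exact ⟨f, fun O hO hfO => hf ⟨O.1, ⟨O, hO, rfl⟩, hfO⟩⟩
  choose f hf using hf
  have hp : ∀ i, ∃ d, ∀ᶠ a in (U : Filter A), f a i = d := by
    intro i
    by_contra! hne
    have := (eventually_cardinal_forall (Order.lt_succ #D)).2
      hne
    obtain ⟨a, ha⟩ := this.exists
    exact ha _ rfl
  choose p hp using hp
  have htend : Tendsto f U (𝓝 p) := by
    rw [tendsto_pi_nhds]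
    intro i
    rw [nhds_discrete, tendsto_pure]
    exact hp i
  obtain ⟨O, hO, hpO⟩ : p ∈ ⋃₀ 𝒰 := hcover ▸ mem_univ p
  obtain ⟨a, haO, hay⟩ :=
    ((htend.eventually ((hopen O hO).eventually_mem hpO)).and (hfine ⟨O, hO⟩)).exists
  exact hf a _ hay haO

theorem isCardLindelof_of_compactSpace {κ : Cardinal.{u}} (hκ : ℵ₀ ≤ κ) (X : Type u)
    [TopologicalSpace X] [CompactSpace X] : IsCardLindelof κ X := by
  intro 𝒰 hopen hcover
  rw [sUnion_eq_biUnion] at hcover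
  obtain ⟨𝒱, h𝒱, hfin, hcov⟩ := isCompact_univ.elim_finite_subcover_image hopen hcover.ge
  refine ⟨𝒱, h𝒱, hfin.lt_aleph0.trans_le hκ, ?_⟩
  rw [sUnion_eq_biUnion]
  exact univ_subset_iff.1 hcov

theorem isStronglyCompactFor_of_isCardLindelof_pi {κ : Cardinal.{u}} {D : Type u}
    [TopologicalSpace D] [DiscreteTopology D]
    (h : ∀ I : Type u, IsCardLindelof κ (I → D)) : IsStronglyCompactFor κ (Order.succ #D) := by
  intro A F hF hFκ
  let e : A → (A → D) → D := fun a f => f a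
  obtain ⟨p, hp⟩ : ∃ p, ∀ X ∈ F, p ∈ closure (e '' X) := by
    -- Otherwise the complements of the closures cover the space; the members of `F` behind a
    -- subcover of size `< κ` would have empty intersection, against `κ`-completeness.
    by_contra! hcon
    obtain ⟨𝒱, h𝒱, hcard, hcov⟩ := h (A → D) {O | ∃ X ∈ F, O = (closure (e '' X))ᶜ}
      (by rintro _ ⟨X, -, rfl⟩; exact isClosed_closure.isOpen_compl)
      (by
        refine eq_univ_of_forall fun p => ?_
        obtain ⟨X, hX, hpX⟩ := hcon p
        exact ⟨_, ⟨X, hX, rfl⟩, hpX⟩)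
    choose X hX hXO using fun O : 𝒱 => h𝒱 O.2
    obtain ⟨a, ha⟩ := hF.nonempty_of_mem ((cardinal_iInter_mem hcard).2 hX)
    obtain ⟨O, hO, haO⟩ : e a ∈ ⋃₀ 𝒱 := hcov ▸ mem_univ _
    rw [show O = _ from hXO ⟨O, hO⟩] at haO
    exact haO (subset_closure ⟨a, mem_iInter.1 ha ⟨O, hO⟩, rfl⟩)
  have hne : (comap e (𝓝 p) ⊓ F).NeBot := by
    rw [inf_neBot_iff]
    rintro s ⟨N, hN, hNs⟩ X hX
    obtain ⟨_, hqN, a, haX, rfl⟩ := mem_closure_iff_nhds.1 (hp X hX) N hN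
    exact ⟨a, hNs hqN, haX⟩
  let U := Ultrafilter.of (comap e (𝓝 p) ⊓ F)
  have hU : (U : Filter A) ≤ comap e (𝓝 p) ⊓ F := Ultrafilter.of_le _
  have hval : ∀ f : A → D, ∀ᶠ a in (U : Filter A), f a = p f := by
    have ht := tendsto_pi_nhds.1 (tendsto_iff_comap.2 (hU.trans inf_le_left))
    intro f
    simpa [nhds_discrete, tendsto_pure] using ht f
  refine ⟨U, hU.trans inf_le_right, ⟨fun S hS hSU => ?_⟩⟩
  rcases S.eq_empty_or_nonempty with rfl | hSne
  · simp
  have : Nonempty S := hSne.to_subtype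
  obtain ⟨i⟩ := Order.lt_succ_iff.1 hS
  by_contra hnot
  have hnot : ∀ᶠ a in (U : Filter A), a ∈ (⋂₀ S)ᶜ := Ultrafilter.compl_mem_iff_notMem.2 hnot
  -- Colour each `a` outside `⋂₀ S` by the code of a member of `S` missing it. The colour is
  -- constant almost everywhere, so a single member of `S` would be missed almost everywhere.
  have hg : ∀ a, ∃ d, a ∈ (⋂₀ S)ᶜ → a ∉ (Function.invFun i d).1 := by
    intro a
    by_cases ha : a ∈ ⋂₀ S
    · exact ⟨i hSne.to_subtype.some, fun h => absurd ha h⟩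
    · obtain ⟨s, hs, has⟩ : ∃ s ∈ S, a ∉ s := by simpa using ha
      exact ⟨i ⟨s, hs⟩, fun _ => by rwa [Function.leftInverse_invFun i.injective]⟩
  choose g hg using hg
  have hmem : ∀ᶠ a in (U : Filter A), a ∈ (Function.invFun i (p g)).1 :=
    hSU _ (Function.invFun i (p g)).2
  obtain ⟨a, ha, hga, haS⟩ := (hnot.and ((hval g).and hmem)).exists
  exact hg a ha (hga ▸ haS)

theorem mainTheorem7 (κ δ : Cardinal.{u}) (hκ : ℵ₀ < κ) (hδ : δ < κ)
    (D : Type u) [TopologicalSpace D] [DiscreteTopology D] (hD : #D = δ) :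
    IsStronglyCompactFor κ (Order.succ δ) ↔
      ∀ (lam : Cardinal.{u}) (I : Type u), #I = lam → IsCardLindelof κ (I → D) := by
  subst hD
  refine ⟨fun h _ I _ => ?_, fun h => isStronglyCompactFor_of_isCardLindelof_pi fun I => h _ I rfl⟩
  -- For finite `D`, `Order.succ #D` is not uncountable, so the singular descent is unavailable; the
  -- power is compact by Tychonoff.
  rcases finite_or_infinite D with hfin | hinf
  · exact isCardLindelof_of_compactSpace hκ.le _
  · exact isCardLindelof_pi_of_hasFineUltrafilter (h.hasFineUltrafilter_self hκ.le
      (Order.lt_succ_iff.2 (Cardinal.aleph0_le_mk D))) I
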